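/- Let $N\ge 0$. For real square matrices put $\langle X,Y\rangle=\operatorname{tr}(X^TY)$, and let $\mathcal S^4$ be the space of real symmetric $4\times4$ matrices. Let $\mathcal A:\mathcal S^4\to\mathbb R^{3\times3}$ be the linear map $$\mathcal A(Z)=\begin{bmatrix} Z_{11}-Z_{22}-Z_{33}+Z_{44} & 2Z_{12}+2Z_{34} & 2Z_{13}-2Z_{24}\\ 2Z_{12}-2Z_{34} & -Z_{11}+Z_{22}-Z_{33}+Z_{44} & 2Z_{23}+2Z_{14}\\ 2Z_{13}+2Z_{24} & 2Z_{23}-2Z_{14} & -Z_{11}-Z_{22}+Z_{33}+Z_{44}\end{bmatrix}$$ (so that $\mathcal A(qq^T)\in SO(3)$ is the rotation represented by the unit quaternion $q$), and let $\mathcal A^*:\mathbb R^{3\times3}\to\mathcal S^4$ be its adjoint with respect to these inner products. For $T_0,\dots,T_N\in\mathcal S^4$ let $\mathrm{Toeplitz}(T_0,\dots,T_N)$ be the symmetric $4(N+1)\times4(N+1)$ block Toeplitz matrix with first block row $T_0,\dots,T_N$, and for $S_1,\dots,S_{2N+1}\in\mathcal S^4$ let $\mathrm{Hankel}(S_1,\dots,S_{2N+1})$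 be the block Hankel matrix whose $(j,k)$ block is $S_{j+k-1}$, $1\le j,k\le N+1$. **Theorem.** (a) Let $A_0,\dots,A_N,B_1,\dots,B_N\in\mathbb R^{3\times3}$. The trigonometric Wahba problem $$\max_{Q\in SO(3),\ \omega\in[-\pi,\pi)}\ \langle A_0,Q\rangle+\sum_{n=1}^N\big[\langle A_n,\cos(n\omega)Q\rangle+\langle B_n,\sin(n\omega)Q\rangle\big]\qquad(1)$$ and the semidefinite program, in the variables $X_0,X_1,Y_1,\dots,X_N,Y_N\in\mathcal S^4$, $$\begin{aligned}\max\ &\langle \mathcal A^*(A_0),X_0\rangle+\sum_{n=1}^N\big[\langle\mathcal A^*(A_n),X_n\rangle+\langle\mathcal A^*(B_n),Y_n\rangle\big]\\ \text{s.t. }&\mathrm{Toeplitz}(X_0,\dots,X_N)+\mathrm{Hankel}(Y_N,\dots,Y_1,0,-Y_1,\dots,-Y_N)\succeq0,\quad \operatorname{tr}(X_0)=1\end{aligned}\qquad(2)$$ both attain their maxima and have the same optimal value, and the set of optimal points of (2) is $$\operatorname{conv}\{(qq^T,qq^T\cos\omega,qq^T\sin\omega,\dots,qq^T\cos(N\omega),qq^T\sin(N\omega)):\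 q\in\mathbb R^4,\ \|q\|=1,\ (\omega,\mathcal A(qq^T))\text{ is an optimal point of }(1)\}.$$ (b) Consequently Psiaki's first problem with constant sampling period has an exact semidefinite reformulation. Let $\tau>0$, $\kappa_n\in\mathbb R$ and $x_n,y_n\in\mathbb R^3$ for $0\le n\le N$ (in applications $\kappa_n\ge0$ and $\|x_n\|=\|y_n\|=1$), let $R(\theta)=\begin{bmatrix}1&0&0\\0&\cos\theta&-\sin\theta\\0&\sin\theta&\cos\theta\end{bmatrix}$, and consider $$\min_{Q\in SO(3),\ \omega\in[-\pi/\tau,\pi/\tau)}\ \sum_{n=0}^N\frac{\kappa_n}{2}\,\|y_n-R(\omega n\tau)Qx_n\|^2.\qquad(3)$$ Take in (2) the matrices $A_0=\kappa_0y_0x_0^T+\operatorname{diag}(1,0,0)\sum_{n=1}^N\kappa_ny_nx_n^T$ and, for $1\le n\le N$, $A_n=\kappa_n\operatorname{diag}(0,1,1)\,y_nx_n^T$, $B_n=\kappa_n\begin{bmatrix}0&0&0\\0&0&1\\0&-1&0\end{bmatrix}y_nx_n^T$. Then both optima are attained, the optimal value of (3) equals $\sum_{n=0}^N\frac{\kappa_n}{2}(\|y_n\|^2+\|x_n\|^2)$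 minus the optimal value of (2), and the set of optimal points of (2) is the convex hull of the tuples $(qq^T,qq^T\cos(\tau\omega),qq^T\sin(\tau\omega),\dots,qq^T\cos(N\tau\omega),qq^T\sin(N\tau\omega))$ with $q\in\mathbb R^4$, $\|q\|=1$ and $(\omega,\mathcal A(qq^T))$ an optimal point of (3). -/

import Mathlib

open scoped Matrix

namespace TrigWahba

noncomputable section

/-- The inner product `tr (Xᵀ Y)` on square real matrices. -/
def matInner {d : ℕ} (X Y : Matrix (Fin d) (Fin d) ℝ) : ℝ := (Xᵀ * Y).trace

/-- The linear map `𝒜` from symmetric `4 × 4` matrices to `3 × 3` matrices; for a unit quaternion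
`q`, `𝒜 (q qᵀ)` is the rotation matrix represented by `q`. -/
def quatMap (Z : Matrix (Fin 4) (Fin 4) ℝ) : Matrix (Fin 3) (Fin 3) ℝ :=
  !![Z 0 0 - Z 1 1 - Z 2 2 + Z 3 3, 2 * Z 0 1 + 2 * Z 2 3, 2 * Z 0 2 - 2 * Z 1 3;
     2 * Z 0 1 - 2 * Z 2 3, -Z 0 0 + Z 1 1 - Z 2 2 + Z 3 3, 2 * Z 1 2 + 2 * Z 0 3;
     2 * Z 0 2 + 2 * Z 1 3, 2 * Z 1 2 - 2 * Z 0 3, -Z 0 0 - Z 1 1 + Z 2 2 + Z 3 3]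

/-- The adjoint `𝒜*` of `𝒜`. -/
def quatAdj (Y : Matrix (Fin 3) (Fin 3) ℝ) : Matrix (Fin 4) (Fin 4) ℝ :=
  !![Y 0 0 - Y 1 1 - Y 2 2, Y 0 1 + Y 1 0, Y 0 2 + Y 2 0, Y 1 2 - Y 2 1;
     Y 0 1 + Y 1 0, -Y 0 0 + Y 1 1 - Y 2 2, Y 1 2 + Y 2 1, -Y 0 2 + Y 2 0;
     Y 0 2 + Y 2 0, Y 1 2 + Y 2 1, -Y 0 0 - Y 1 1 + Y 2 2, Y 0 1 - Y 1 0;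
     Y 1 2 - Y 2 1, -Y 0 2 + Y 2 0, Y 0 1 - Y 1 0, Y 0 0 + Y 1 1 + Y 2 2]

/-- `𝒜*` is the adjoint of `𝒜` with respect to the trace inner products. -/
theorem matInner_quatMap (Z : Matrix (Fin 4) (Fin 4) ℝ) (hZ : Z.IsSymm)
    (Y : Matrix (Fin 3) (Fin 3) ℝ) : matInner (quatMap Z) Y = matInner Z (quatAdj Y) := by
  have h : ∀ i j, Z i j = Z j i := fun i j => hZ.apply j i
  simp [matInner, quatMap, quatAdj, Matrix.trace, Matrix.mul_apply, Fin.sum_univ_succ]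
  rw [h 1 0, h 2 0, h 3 0, h 2 1, h 3 1, h 3 2]
  ring

/-- The symmetric block Toeplitz matrix with first block row `T 0, T 1, …, T N`. -/
def blockToeplitz {d N : ℕ} (T : Fin (N + 1) → Matrix (Fin d) (Fin d) ℝ) :
    Matrix (Fin (N + 1) × Fin d) (Fin (N + 1) × Fin d) ℝ :=
  Matrix.of fun p r =>
    if p.1 ≤ r.1 then T ⟨r.1.val - p.1.val, by omega⟩ p.2 r.2
    else (T ⟨p.1.val - r.1.val, by omega⟩)ᵀ p.2 r.2

/-- The block Hankel matrix of `2 N + 1` blocks: the block in position `(j, k)`,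
`0 ≤ j, k ≤ N`, is `S (j + k)`. -/
def blockHankel {d N : ℕ} (S : Fin (2 * N + 1) → Matrix (Fin d) (Fin d) ℝ) :
    Matrix (Fin (N + 1) × Fin d) (Fin (N + 1) × Fin d) ℝ :=
  Matrix.of fun p r => S ⟨p.1.val + r.1.val, by omega⟩ p.2 r.2

/-- The sequence `Y_N, Y_{N-1}, …, Y_1, 0, -Y_1, …, -Y_{N-1}, -Y_N`, where `Y n` stands for
`Y_{n+1}`. -/
def hankelSeq {d N : ℕ} (Y : Fin N → Matrix (Fin d) (Fin d) ℝ) :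
    Fin (2 * N + 1) → Matrix (Fin d) (Fin d) ℝ := fun m =>
  if h : m.val < N then Y ⟨N - 1 - m.val, by omega⟩
  else if h' : m.val = N then 0
  else -Y ⟨m.val - N - 1, by omega⟩

/-- Tuples `((X_0, …, X_N), (Y_1, …, Y_N))` of `4 × 4` matrices; `p.2 n` is `Y_{n+1}`. -/
abbrev Tuple (N : ℕ) : Type :=
  (Fin (N + 1) → Matrix (Fin 4) (Fin 4) ℝ) × (Fin N → Matrix (Fin 4) (Fin 4) ℝ)

/-- The domain `[-π, π) × SO(3)` of the trigonometric Wahba problem. -/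
def wahbaDomain : Set (ℝ × Matrix (Fin 3) (Fin 3) ℝ) :=
  {s | s.1 ∈ Set.Ico (-Real.pi) Real.pi ∧ s.2 ∈ Matrix.specialOrthogonalGroup (Fin 3) ℝ}

/-- The objective of the trigonometric Wahba problem at `(ω, Q)`; `B n` stands for `B_{n+1}`. -/
def wahbaObj {N : ℕ} (A : Fin (N + 1) → Matrix (Fin 3) (Fin 3) ℝ)
    (B : Fin N → Matrix (Fin 3) (Fin 3) ℝ) (s : ℝ × Matrix (Fin 3) (Fin 3) ℝ) : ℝ :=
  matInner (A 0) s.2 + ∑ n : Fin N,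
    (matInner (A n.succ) (Real.cos (((n : ℕ) + 1 : ℝ) * s.1) • s.2) +
      matInner (B n) (Real.sin (((n : ℕ) + 1 : ℝ) * s.1) • s.2))

/-- The feasible set of the semidefinite program. -/
def sdpFeasible (N : ℕ) : Set (Tuple N) :=
  {p | (∀ n, (p.1 n).IsSymm) ∧ (∀ n, (p.2 n).IsSymm) ∧
    (blockToeplitz p.1 + blockHankel (hankelSeq p.2)).PosSemidef ∧ (p.1 0).trace = 1}

/-- The linear objective of the semidefinite program. -/
def sdpObj {N : ℕ} (A : Fin (N + 1) → Matrix (Fin 3) (Fin 3) ℝ)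
    (B : Fin N → Matrix (Fin 3) (Fin 3) ℝ) (p : Tuple N) : ℝ :=
  matInner (quatAdj (A 0)) (p.1 0) + ∑ n : Fin N,
    (matInner (quatAdj (A n.succ)) (p.1 n.succ) + matInner (quatAdj (B n)) (p.2 n))

/-- The set of optimal points of the semidefinite program. -/
def sdpOptimal {N : ℕ} (A : Fin (N + 1) → Matrix (Fin 3) (Fin 3) ℝ)
    (B : Fin N → Matrix (Fin 3) (Fin 3) ℝ) : Set (Tuple N) :=
  {p | p ∈ sdpFeasible N ∧ IsMaxOn (sdpObj A B) (sdpFeasible N) p}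

/-- The rank one matrix `q qᵀ`. -/
def outer (q : Fin 4 → ℝ) : Matrix (Fin 4) (Fin 4) ℝ := Matrix.vecMulVec q q

/-- The moment tuple `X_n = cos (n ω) q qᵀ` (`0 ≤ n ≤ N`), `Y_n = sin (n ω) q qᵀ`
(`1 ≤ n ≤ N`). -/
def moment (N : ℕ) (q : Fin 4 → ℝ) (ω : ℝ) : Tuple N :=
  (fun n => Real.cos (((n : ℕ) : ℝ) * ω) • outer q,
   fun n => Real.sin (((n : ℕ) + 1 : ℝ) * ω) • outer q)

/-- The rotation by the angle `θ` about the first body axis. -/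
def spin (θ : ℝ) : Matrix (Fin 3) (Fin 3) ℝ :=
  !![1, 0, 0; 0, Real.cos θ, -Real.sin θ; 0, Real.sin θ, Real.cos θ]

/-- The domain `[-π/τ, π/τ) × SO(3)` of Psiaki's first problem with sampling period `τ`. -/
def psiakiDomain (τ : ℝ) : Set (ℝ × Matrix (Fin 3) (Fin 3) ℝ) :=
  {s | s.1 ∈ Set.Ico (-(Real.pi / τ)) (Real.pi / τ) ∧
    s.2 ∈ Matrix.specialOrthogonalGroup (Fin 3) ℝ}

/-- The least squares cost of Psiaki's first problem,
`∑ n, (κ_n / 2) ‖y_n - Q(n τ) x_n‖²` with `Q(t) = spin (ω t) Q(0)`, at `(ω, Q(0))`. -/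
def psiakiCost {N : ℕ} (τ : ℝ) (κ : Fin (N + 1) → ℝ) (x y : Fin (N + 1) → EuclideanSpace ℝ (Fin 3))
    (s : ℝ × Matrix (Fin 3) (Fin 3) ℝ) : ℝ :=
  ∑ n : Fin (N + 1), κ n / 2 *
    ‖y n - WithLp.toLp 2 ((spin (s.1 * (((n : ℕ) : ℝ) * τ)) * s.2) *ᵥ (x n).ofLp)‖ ^ 2

/-- The coefficients `A_0, …, A_N` of Psiaki's first problem. -/
def psiakiA {N : ℕ} (κ : Fin (N + 1) → ℝ) (x y : Fin (N + 1) → EuclideanSpace ℝ (Fin 3)) :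
    Fin (N + 1) → Matrix (Fin 3) (Fin 3) ℝ :=
  Fin.cons
    (κ 0 • Matrix.vecMulVec (y 0).ofLp (x 0).ofLp +
      !![1, 0, 0; 0, 0, 0; 0, 0, 0] *
        ∑ n : Fin N, κ n.succ • Matrix.vecMulVec (y n.succ).ofLp (x n.succ).ofLp)
    (fun n : Fin N => κ n.succ •
      (!![0, 0, 0; 0, 1, 0; 0, 0, 1] * Matrix.vecMulVec (y n.succ).ofLp (x n.succ).ofLp))

/-- The coefficients `B_1, …, B_N` of Psiaki's first problem. -/
def psiakiB {N : ℕ} (κ : Fin (N + 1) → ℝ) (x y : Fin (N + 1) → EuclideanSpace ℝ (Fin 3)) :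
    Fin N → Matrix (Fin 3) (Fin 3) ℝ := fun n =>
  κ n.succ • (!![0, 0, 0; 0, 0, 1; 0, -1, 0] *
    Matrix.vecMulVec (y n.succ).ofLp (x n.succ).ofLp)

end

end TrigWahba

/-! The semidefinite feasible set is exactly the convex hull of the moment tuples of unit
quaternions and angles (`sdpFeasible_eq_convexHull`). A linear objective on a convex hull is maximal
on the hull of its maximal generators (`convexHull_inter_eq`). Every rotation comes from a unit
quaternion (`exists_quatMap_outer_eq`), and on moment tuples the objective is the Wahba objective,
by adjointness. Equality of values and the description of the optimal set follow.

The hard inclusion is `sdpFeasible_subset`. Factor the Toeplitz-plus-Hankel matrix as a real Gram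
matrix and combine block `j`, as real part, with the reversed block `N - j`, as imaginary part. The
Hankel contributions disappear, leaving complex vectors with block Toeplitz Gram matrix. The shift
on them extends to an isometry, and its eigenvectors give an atomic measure on the circle
(`exists_trigonometric_representation`). Symmetry of the blocks makes the weights real.

Psiaki's problem reduces to the Wahba problem by expanding the squares and rescaling `ω` by `τ`. -/

namespace TrigWahba

/-! ### Isometries, Gram matrices and trigonometric moments -/

open Module Module.End in
/-- A linear isometry of a finite-dimensional complex inner product space has an orthonormal basis
of eigenvectors, with eigenvalues of modulus one. -/
theorem exists_orthonormalBasis_eigenvectors {E : Type*} [NormedAddCommGroup E]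
    [InnerProductSpace ℂ E] [FiniteDimensional ℂ E] (U : E →ₗᵢ[ℂ] E) :
    ∃ (b : OrthonormalBasis (Fin (finrank ℂ E)) ℂ E) (μ : Fin (finrank ℂ E) → ℂ),
      ∀ l, ‖μ l‖ = 1 ∧ U (b l) = μ l • b l := by
  classical
  set T : E →ₗ[ℂ] E := U.toLinearMap with hTdef
  have hT : ∀ x y, inner ℂ (T x) (T y) = inner ℂ x y := fun x y => U.inner_map_map x y
  have hunit : ∀ (μ : ℂ) (x : E), x ≠ 0 → T x = μ • x → ‖μ‖ = 1 := by
    intro μ x hx h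
    have h1 : ‖T x‖ = ‖x‖ := U.norm_map x
    rw [h, norm_smul] at h1
    exact mul_right_cancel₀ (norm_ne_zero_iff.mpr hx) (by rw [h1, one_mul])
  -- An eigenvector of an isometry is also one of its adjoint. This takes the place of
  -- self-adjointness in the usual spectral argument: it yields orthogonality of eigenspaces and
  -- invariance of their orthogonal complement.
  have hconj : ∀ (μ : ℂ) (x : E), x ≠ 0 → T x = μ • x → ∀ y,
      inner ℂ x (T y) = μ * inner ℂ x y := by
    intro μ x hx h y
    have h1 : μ * (starRingEnd ℂ) μ = 1 := by
      rw [Complex.mul_conj, Complex.normSq_eq_norm_sq, hunit μ x hx h]; simp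
    rw [← hT x y, h, inner_smul_left, ← mul_assoc, h1, one_mul]
  have horth : OrthogonalFamily ℂ (fun μ => eigenspace T μ)
      fun μ => (eigenspace T μ).subtypeₗᵢ := by
    rintro μ ν hμν ⟨v, hv⟩ ⟨w, hw⟩
    rw [mem_eigenspace_iff] at hv hw
    by_cases hv' : v = 0
    · simp [hv']
    have h1 := hconj μ v hv' hv w
    rw [hw, inner_smul_right] at h1
    exact (mul_eq_mul_right_iff.mp h1).resolve_left hμν.symm
  have hinv : ∀ v ∈ (⨆ μ, eigenspace T μ)ᗮ, T v ∈ (⨆ μ, eigenspace T μ)ᗮ := by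
    intro v hv
    rw [← Submodule.iInf_orthogonal, Submodule.mem_iInf] at hv ⊢
    intro μ w hw
    by_cases hw' : w = 0
    · simp [hw']
    rw [hconj μ w hw' (mem_eigenspace_iff.mp hw), hv μ w hw, mul_zero]
  have hbot : (⨆ μ, eigenspace T μ)ᗮ = ⊥ := by
    by_contra hne
    have : Nontrivial ↥(⨆ μ, eigenspace T μ)ᗮ := Submodule.nontrivial_iff_ne_bot.mpr hne
    obtain ⟨c, hc⟩ := Module.End.exists_eigenvalue (T.restrict hinv)
    refine hc (eigenspace_restrict_eq_bot hinv ?_)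
    have H₂ : eigenspace T c ⟂ (⨆ μ, eigenspace T μ)ᗮ :=
      (Submodule.isOrtho_orthogonal_right _).mono_left (le_iSup _ _)
    exact H₂.disjoint
  have horth' : OrthogonalFamily ℂ (fun μ : Eigenvalues T => eigenspace T μ)
      fun μ => (eigenspace T μ).subtypeₗᵢ := horth.comp Subtype.coe_injective
  have hint : DirectSum.IsInternal fun μ : Eigenvalues T => eigenspace T μ := by
    refine horth'.isInternal_iff.mpr ?_
    change (⨆ μ : { μ // eigenspace T μ ≠ ⊥ }, eigenspace T μ)ᗮ = ⊥
    rw [iSup_ne_bot_subtype, hbot]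
  refine ⟨hint.subordinateOrthonormalBasis rfl horth',
    fun l => (hint.subordinateOrthonormalBasisIndex rfl l horth').val, fun l => ?_⟩
  have h := mem_eigenspace_iff.mp (hint.subordinateOrthonormalBasis_subordinate rfl l horth')
  refine ⟨hunit _ _ ?_ h, h⟩
  simpa using (hint.subordinateOrthonormalBasis rfl horth').toBasis.ne_zero l

/-- Two finite families with the same Gram matrix differ by a linear isometry. -/
theorem exists_linearIsometry_of_gram_eq {E ι : Type*} [NormedAddCommGroup E]
    [InnerProductSpace ℂ E] [FiniteDimensional ℂ E] [Fintype ι] (f g : ι → E)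
    (h : ∀ i j, inner ℂ (f i) (f j) = inner ℂ (g i) (g j)) :
    ∃ U : E →ₗᵢ[ℂ] E, ∀ i, U (f i) = g i := by
  classical
  set F : (ι → ℂ) →ₗ[ℂ] E := Fintype.linearCombination ℂ f with hF
  set G : (ι → ℂ) →ₗ[ℂ] E := Fintype.linearCombination ℂ g with hG
  have hnorm : ∀ c, ‖F c‖ = ‖G c‖ := by
    intro c
    have : inner ℂ (F c) (F c) = inner ℂ (G c) (G c) := by
      simp only [hF, hG, Fintype.linearCombination_apply, sum_inner, inner_sum, inner_smul_left,
        inner_smul_right, h]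
    rw [@norm_eq_sqrt_re_inner ℂ, @norm_eq_sqrt_re_inner ℂ, this]
  -- The section is arbitrary: by `hnorm` the kernels of `F` and `G` agree, so `F c ↦ G c` is well
  -- defined on the range.
  obtain ⟨s, hs⟩ := F.rangeRestrict.exists_rightInverse_of_surjective F.range_rangeRestrict
  have hs' : ∀ x : LinearMap.range F, F (s x) = x := fun x =>
    congrArg Subtype.val (LinearMap.congr_fun hs x)
  let L : LinearMap.range F →ₗᵢ[ℂ] E :=
    { toLinearMap := G ∘ₗ s
      norm_map' := fun x => by
        change ‖G (s x)‖ = ‖x‖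
        rw [← hnorm, hs']; rfl }
  have hL : ∀ c, L ⟨F c, LinearMap.mem_range_self F c⟩ = G c := by
    intro c
    change G (s _) = G c
    rw [← sub_eq_zero, ← map_sub, ← norm_eq_zero, ← hnorm, map_sub, hs', sub_self, norm_zero]
  refine ⟨L.extend, fun i => ?_⟩
  have h1 : F (Pi.single i 1) = f i := by simp [hF]
  have h2 : G (Pi.single i 1) = g i := by simp [hG]
  have h3 := L.extend_apply ⟨F (Pi.single i 1), LinearMap.mem_range_self F _⟩
  rw [hL, h2] at h3
  rw [← h1]; exact h3

/-- A family of vectors with block Toeplitz Gram matrix has trigonometric moments: its Gram matrix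
is represented by a finitely supported matrix-valued measure on the circle. -/
theorem exists_trigonometric_representation {E α : Type*} [NormedAddCommGroup E]
    [InnerProductSpace ℂ E] [FiniteDimensional ℂ E] [Fintype α] {N : ℕ}
    (v : Fin (N + 1) → α → E)
    (hv : ∀ (j k : Fin N) (a b : α),
      inner ℂ (v j.succ a) (v k.succ b) = inner ℂ (v j.castSucc a) (v k.castSucc b)) :
    ∃ (m : ℕ) (θ : Fin m → ℝ) (c : Fin m → α → ℂ), (∀ l, θ l ∈ Set.Ico (-Real.pi) Real.pi) ∧
      ∀ (n : Fin (N + 1)) (a b : α), inner ℂ (v n a) (v 0 b) =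
        ∑ l, Complex.exp (((n : ℕ) * θ l : ℝ) * Complex.I) *
          ((starRingEnd ℂ) (c l a) * c l b) := by
  -- The Toeplitz property says that the shift `v j ↦ v (j + 1)` preserves inner products.
  obtain ⟨U, hU⟩ := exists_linearIsometry_of_gram_eq
    (fun p : Fin N × α => v p.1.castSucc p.2) (fun p => v p.1.succ p.2)
    (fun p r => (hv p.1 r.1 p.2 r.2).symm)
  obtain ⟨b, μ, hb⟩ := exists_orthonormalBasis_eigenvectors U
  have hconj : ∀ l x, inner ℂ (b l) (U x) = μ l * inner ℂ (b l) x := by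
    intro l x
    have h1 : μ l * (starRingEnd ℂ) (μ l) = 1 := by
      rw [Complex.mul_conj, Complex.normSq_eq_norm_sq, (hb l).1]; simp
    rw [← U.inner_map_map (b l) x, (hb l).2, inner_smul_left, ← mul_assoc, h1, one_mul]
  have hpow : ∀ l (n : Fin (N + 1)) a, inner ℂ (b l) (v n a) =
      μ l ^ (n : ℕ) * inner ℂ (b l) (v 0 a) := by
    intro l n a
    induction n using Fin.induction with
    | zero => simp
    | succ j ih =>
      have := hU (j, a)
      simp only at this
      rw [← this, hconj, ih]
      simp [pow_succ]; ring
  -- The minus sign comes from conjugate-linearity in the first argument; it also turns the range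
  -- `(-π, π]` of `arg` into `[-π, π)`.
  refine ⟨_, fun l => -(μ l).arg, fun l a => inner ℂ (b l) (v 0 a), fun l => ?_, fun n a a' => ?_⟩
  · exact ⟨neg_le_neg (Complex.arg_le_pi _), neg_lt.mpr (Complex.neg_pi_lt_arg _)⟩
  · rw [← b.sum_inner_mul_inner]
    refine Finset.sum_congr rfl fun l _ => ?_
    have hμ : (starRingEnd ℂ) (μ l) = Complex.exp (-((μ l).arg * Complex.I)) := by
      conv_lhs => rw [← Complex.norm_mul_exp_arg_mul_I (μ l), (hb l).1]
      simp [← Complex.exp_conj]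
    rw [← inner_conj_symm (v n a), hpow, map_mul, map_pow, hμ, ← Complex.exp_nat_mul, mul_assoc]
    congr 2
    push_cast; ring

/-! ### Block entries through even and odd extensions -/

/-- The even extension to `ℤ` of `X_0, …, X_N`, by zero outside `[-N, N]`. -/
noncomputable def evenExt {N : ℕ} (X : Fin (N + 1) → Matrix (Fin 4) (Fin 4) ℝ) (d : ℤ) :
    Matrix (Fin 4) (Fin 4) ℝ :=
  if h : d.natAbs < N + 1 then X ⟨d.natAbs, h⟩ else 0

/-- The odd extension to `ℤ` of `Y_1, …, Y_N`, by zero outside `[-N, N]`. -/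
noncomputable def oddExt {N : ℕ} (Y : Fin N → Matrix (Fin 4) (Fin 4) ℝ) (d : ℤ) :
    Matrix (Fin 4) (Fin 4) ℝ :=
  if h : d.natAbs - 1 < N then d.sign • Y ⟨d.natAbs - 1, h⟩ else 0

theorem evenExt_neg {N : ℕ} (X : Fin (N + 1) → Matrix (Fin 4) (Fin 4) ℝ) (d : ℤ) :
    evenExt X (-d) = evenExt X d := by
  simp [evenExt]

theorem oddExt_neg {N : ℕ} (Y : Fin N → Matrix (Fin 4) (Fin 4) ℝ) (d : ℤ) :
    oddExt Y (-d) = -oddExt Y d := by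
  unfold oddExt
  simp only [Int.natAbs_neg, Int.sign_neg]
  split_ifs <;> simp

theorem blockToeplitz_apply {N : ℕ} {X : Fin (N + 1) → Matrix (Fin 4) (Fin 4) ℝ}
    (hX : ∀ n, (X n).IsSymm) (j k : Fin (N + 1)) (a b : Fin 4) :
    blockToeplitz X (j, a) (k, b) = evenExt X ((j : ℤ) - k) a b := by
  have hj := j.2
  have hk := k.2
  have h1 : ((j : ℤ) - k).natAbs < N + 1 := by omega
  simp only [blockToeplitz, Matrix.of_apply, evenExt, dif_pos h1]
  split_ifs with h
  · rw [Fin.le_def] at h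
    exact congrArg (fun i => X i a b) (Fin.ext (by dsimp only; omega))
  · rw [Fin.le_def] at h
    rw [(hX _).eq]
    exact congrArg (fun i => X i a b) (Fin.ext (by dsimp only; omega))

theorem blockHankel_hankelSeq_apply {N : ℕ} (Y : Fin N → Matrix (Fin 4) (Fin 4) ℝ)
    (j k : Fin (N + 1)) (a b : Fin 4) :
    blockHankel (hankelSeq Y) (j, a) (k, b) = oddExt Y ((N : ℤ) - j - k) a b := by
  have hj := j.2
  have hk := k.2
  simp only [blockHankel, Matrix.of_apply, hankelSeq, oddExt]
  by_cases h : j.val + k.val < N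
  · have h1 : ((N : ℤ) - j - k).natAbs - 1 < N := by omega
    have h2 : ((N : ℤ) - j - k).sign = 1 := Int.sign_eq_one_of_pos (by omega)
    rw [dif_pos h, dif_pos h1, h2, one_smul]
    exact congrArg (fun i => Y i a b) (Fin.ext (by dsimp only; omega))
  by_cases h' : j.val + k.val = N
  -- At offset zero the truncated index `0 - 1 = 0` is harmless, because the sign factor is zero.
  · have h2 : ((N : ℤ) - j - k) = 0 := by omega
    rw [dif_neg h, dif_pos h', h2]
    simp
  · have h1 : ((N : ℤ) - j - k).natAbs - 1 < N := by omega
    have h2 : ((N : ℤ) - j - k).sign = -1 := Int.sign_eq_neg_one_of_neg (by omega)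
    rw [dif_neg h, dif_neg h', dif_pos h1, h2, neg_one_smul]
    exact congrArg (fun i => (-Y i) a b) (Fin.ext (by dsimp only; omega))

/-! ### The feasible set as a convex hull of moment tuples -/

/-- The moment tuples with unit quaternion and angle in `[-π, π)`. -/
def momentSet (N : ℕ) : Set (Tuple N) :=
  {p | ∃ (q : Fin 4 → ℝ) (ω : ℝ), q ⬝ᵥ q = 1 ∧ ω ∈ Set.Ico (-Real.pi) Real.pi ∧ p = moment N q ω}

theorem outer_smul (t : ℝ) (q : Fin 4 → ℝ) : outer (t • q) = (t ^ 2) • outer q := by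
  ext i j
  simp [outer, Matrix.vecMulVec_apply]
  ring

theorem moment_smul (N : ℕ) (t : ℝ) (q : Fin 4 → ℝ) (ω : ℝ) :
    moment N (t • q) ω = (t ^ 2) • moment N q ω := by
  simp only [moment, outer_smul, Prod.smul_mk]
  congr 1 <;> funext n <;> simp only [Pi.smul_apply] <;> rw [smul_comm]

theorem exists_unit_moment_eq (N : ℕ) (q : Fin 4 → ℝ) (ω : ℝ) :
    ∃ q' : Fin 4 → ℝ, q' ⬝ᵥ q' = 1 ∧ moment N q ω = (q ⬝ᵥ q) • moment N q' ω := by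
  by_cases hq : q = 0
  · refine ⟨Pi.single 0 1, by simp, ?_⟩
    have := moment_smul N 0 q ω
    subst hq
    simpa using this
  · have h0 : 0 < q ⬝ᵥ q := by
      have h1 : 0 ≤ q ⬝ᵥ q := Finset.sum_nonneg fun i _ => mul_self_nonneg _
      exact lt_of_le_of_ne h1 fun h => hq (dotProduct_self_eq_zero.mp h.symm)
    have hs : √(q ⬝ᵥ q) ^ 2 = q ⬝ᵥ q := Real.sq_sqrt h0.le
    have hs' : √(q ⬝ᵥ q) ≠ 0 := (Real.sqrt_pos.mpr h0).ne'
    refine ⟨(√(q ⬝ᵥ q))⁻¹ • q, ?_, ?_⟩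
    · rw [smul_dotProduct, dotProduct_smul, smul_eq_mul, smul_eq_mul, ← mul_assoc, ← mul_inv,
        ← sq, hs, inv_mul_cancel₀ h0.ne']
    · rw [moment_smul, inv_pow, hs, smul_smul, mul_inv_cancel₀ h0.ne', one_smul]

theorem sum_moment_mem_convexHull {N : ℕ} {ι : Type*} [Fintype ι] (w : ι → ℝ) (r : ι → Fin 4 → ℝ)
    (θ : ι → ℝ) (hw : ∀ i, 0 ≤ w i) (hθ : ∀ i, θ i ∈ Set.Ico (-Real.pi) Real.pi)
    (hsum : ∑ i, w i * (r i ⬝ᵥ r i) = 1) :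
    ∑ i, w i • moment N (r i) (θ i) ∈ convexHull ℝ (momentSet N) := by
  choose q hq hqm using fun i => exists_unit_moment_eq N (r i) (θ i)
  have : ∑ i, w i • moment N (r i) (θ i) =
      ∑ i, (w i * (r i ⬝ᵥ r i)) • moment N (q i) (θ i) := by
    refine Finset.sum_congr rfl fun i _ => ?_
    rw [hqm i, smul_smul]
  rw [this]
  refine (convex_convexHull ℝ _).sum_mem (fun i _ => mul_nonneg (hw i)
    (Finset.sum_nonneg fun i _ => mul_self_nonneg _)) hsum fun i _ => ?_
  exact subset_convexHull ℝ _ ⟨q i, θ i, hq i, hθ i, rfl⟩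

/-- A matrix trigonometric moment sequence in real form: the data of a feasible point of the
semidefinite program come from a finite sum of moment tuples. -/
theorem sdpFeasible_subset (N : ℕ) : sdpFeasible N ⊆ convexHull ℝ (momentSet N) := by
  rintro ⟨X, Y⟩ ⟨hX, hY, hpsd, htr⟩
  simp only at hX hY hpsd htr
  obtain ⟨m, w, hw⟩ := Matrix.posSemidef_iff_eq_sum_vecMulVec.mp hpsd
  have hM : ∀ (j k : Fin (N + 1)) (a b : Fin 4), ∑ i, w i (j, a) * w i (k, b) =
      evenExt X ((j : ℤ) - k) a b + oddExt Y ((N : ℤ) - j - k) a b := by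
    intro j k a b
    have h := congrFun (congrFun hw (j, a)) (k, b)
    rw [Matrix.add_apply, blockToeplitz_apply hX, blockHankel_hankelSeq_apply,
      Matrix.sum_apply] at h
    rw [h]
    simp [Matrix.vecMulVec_apply]
  -- Reversing both indices keeps the Toeplitz term and negates the Hankel term, so only `X`
  -- survives in the real part of the Gram matrix. In the imaginary part the `X` terms cancel and
  -- the odd `Y` terms add.
  let v : Fin (N + 1) → Fin 4 → EuclideanSpace ℂ (Fin m) := fun j a =>
    WithLp.toLp 2 fun i => (w i (j, a) : ℂ) - w i (j.rev, a) * Complex.I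
  have hv : ∀ j k a b, inner ℂ (v j a) (v k b) =
      2 * ((evenExt X ((j : ℤ) - k) a b : ℂ) + oddExt Y ((j : ℤ) - k) a b * Complex.I) := by
    intro j k a b
    have hj := j.2
    have hk := k.2
    have e : inner ℂ (v j a) (v k b) =
        ((∑ i, w i (j, a) * w i (k, b) + ∑ i, w i (j.rev, a) * w i (k.rev, b) : ℝ) : ℂ) +
        ((∑ i, w i (j.rev, a) * w i (k, b) - ∑ i, w i (j, a) * w i (k.rev, b) : ℝ) : ℂ) *
          Complex.I := by
      simp only [v, PiLp.inner_apply, RCLike.inner_apply]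
      push_cast
      rw [← Finset.sum_add_distrib, ← Finset.sum_sub_distrib, Finset.sum_mul,
        ← Finset.sum_add_distrib]
      refine Finset.sum_congr rfl fun i _ => ?_
      simp only [map_sub, map_mul, Complex.conj_ofReal, Complex.conj_I]
      linear_combination (-(w i (k.rev, b) : ℂ) * w i (j.rev, a)) * Complex.I_sq
    have r1 : ((j.rev : ℕ) : ℤ) = N - j := by rw [Fin.val_rev]; omega
    have r2 : ((k.rev : ℕ) : ℤ) = N - k := by rw [Fin.val_rev]; omega
    rw [e, hM, hM, hM, hM, r1, r2]
    have e1 : (N : ℤ) - j - (N - k) = -((j : ℤ) - k) := by ring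
    have e2 : (N : ℤ) - (N - j) - (N - k) = -((N : ℤ) - j - k) := by ring
    have e3 : (N : ℤ) - (N - j) - k = (j : ℤ) - k := by ring
    have e4 : (j : ℤ) - (N - k) = -((N : ℤ) - j - k) := by ring
    rw [e1, e2, e3, e4, evenExt_neg, evenExt_neg, oddExt_neg, oddExt_neg]
    simp only [Matrix.neg_apply]
    push_cast
    ring
  obtain ⟨M, θ, c, hθ, hc⟩ := exists_trigonometric_representation v (by
    intro j k a b
    rw [hv, hv]
    simp)
  -- Averaging the `(a, b)` and `(b, a)` entries, equal by symmetry, replaces the Hermitian rank-one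
  -- weight by its real part.
  have hsym : ∀ (n : Fin (N + 1)) a b,
      (evenExt X (n : ℤ) a b : ℂ) + oddExt Y (n : ℤ) a b * Complex.I =
      ∑ l, Complex.exp (((n : ℕ) * θ l : ℝ) * Complex.I) *
        ((1 / 2 * ((c l a).re * (c l b).re + (c l a).im * (c l b).im) : ℝ) : ℂ) := by
    intro n a b
    have h1 := (hv n 0 a b).symm.trans (hc n a b)
    have h2 := (hv n 0 b a).symm.trans (hc n b a)
    have s1 : evenExt X (n : ℤ) b a = evenExt X (n : ℤ) a b := by
      unfold evenExt
      split_ifs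
      · exact (hX _).apply _ _
      · rfl
    have s2 : oddExt Y (n : ℤ) b a = oddExt Y (n : ℤ) a b := by
      unfold oddExt
      split_ifs
      · simp only [Matrix.smul_apply, (hY _).apply b a]
      · rfl
    simp only [Fin.val_zero, Nat.cast_zero, sub_zero] at h1 h2
    rw [s1, s2] at h2
    have h3 : 4 * ((evenExt X (n : ℤ) a b : ℂ) + oddExt Y (n : ℤ) a b * Complex.I) =
      4 * ∑ l, Complex.exp (((n : ℕ) * θ l : ℝ) * Complex.I) *
        ((1 / 2 * ((c l a).re * (c l b).re + (c l a).im * (c l b).im) : ℝ) : ℂ) := by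
      have : 4 * ((evenExt X (n : ℤ) a b : ℂ) + oddExt Y (n : ℤ) a b * Complex.I) =
          2 * ((evenExt X (n : ℤ) a b : ℂ) + oddExt Y (n : ℤ) a b * Complex.I) +
          2 * ((evenExt X (n : ℤ) a b : ℂ) + oddExt Y (n : ℤ) a b * Complex.I) := by ring
      rw [this]
      nth_rewrite 1 [h1]
      rw [h2, ← Finset.sum_add_distrib, Finset.mul_sum]
      refine Finset.sum_congr rfl fun l _ => ?_
      rw [← mul_add, mul_left_comm]
      congr 1
      apply Complex.ext <;> simp <;> ring
    exact mul_left_cancel₀ (by norm_num) h3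
  have hre : ∀ (n : Fin (N + 1)) a b, evenExt X (n : ℤ) a b =
      ∑ l, Real.cos ((n : ℕ) * θ l) *
        (1 / 2 * ((c l a).re * (c l b).re + (c l a).im * (c l b).im)) := by
    intro n a b
    have h := congrArg Complex.re (hsym n a b)
    rw [Complex.re_sum] at h
    simp only [Complex.re_mul_ofReal, Complex.exp_ofReal_mul_I_re, Complex.add_re,
      Complex.ofReal_re, Complex.I_re, Complex.re_ofReal_mul, mul_zero, add_zero] at h
    exact h
  have him : ∀ (n : Fin (N + 1)) a b, oddExt Y (n : ℤ) a b =
      ∑ l, Real.sin ((n : ℕ) * θ l) *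
        (1 / 2 * ((c l a).re * (c l b).re + (c l a).im * (c l b).im)) := by
    intro n a b
    have h := congrArg Complex.im (hsym n a b)
    rw [Complex.im_sum] at h
    simp only [Complex.im_mul_ofReal, Complex.exp_ofReal_mul_I_im, Complex.add_im,
      Complex.ofReal_im, Complex.I_im, Complex.im_ofReal_mul, mul_one, zero_add] at h
    exact h
  have hXe : ∀ (n : Fin (N + 1)), evenExt X (n : ℤ) = X n := by
    intro n
    have h1 : ((n : ℕ) : ℤ).natAbs < N + 1 := by have := n.2; omega
    rw [evenExt, dif_pos h1]; simp
  have hYe : ∀ (n : Fin N), oddExt Y ((n.succ : ℕ) : ℤ) = Y n := by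
    intro n
    have h1 : ((n.succ : ℕ) : ℤ).natAbs - 1 < N := by have := n.2; rw [Fin.val_succ]; omega
    have h2 : ((n.succ : ℕ) : ℤ).sign = 1 := Int.sign_eq_one_of_pos (by simp)
    rw [oddExt, dif_pos h1, h2, one_smul]
    exact congrArg Y (Fin.ext (by simp only [Fin.val_succ]; omega))
  -- The real part of a complex rank-one weight is the sum of two real ones, from the real and
  -- imaginary parts of `c`.
  let r : Fin M × Bool → Fin 4 → ℝ := fun p a => if p.2 then (c p.1 a).re else (c p.1 a).im
  have key : ((X, Y) : Tuple N) = ∑ p : Fin M × Bool, (1 / 2 : ℝ) • moment N (r p) (θ p.1) := by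
    refine Prod.ext ?_ ?_
    · funext n
      ext a b
      change X n a b = _
      rw [← hXe, hre]
      simp only [Prod.fst_sum, Finset.sum_apply, Matrix.sum_apply, Fintype.sum_prod_type,
        Fintype.sum_bool]
      refine Finset.sum_congr rfl fun l _ => ?_
      simp [r, moment, outer, Matrix.vecMulVec_apply]
      ring
    · funext n
      ext a b
      change Y n a b = _
      rw [← hYe, him]
      simp only [Prod.snd_sum, Finset.sum_apply, Matrix.sum_apply, Fintype.sum_prod_type,
        Fintype.sum_bool]
      refine Finset.sum_congr rfl fun l _ => ?_
      simp [r, moment, outer, Matrix.vecMulVec_apply]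
      ring
  rw [key]
  refine sum_moment_mem_convexHull (fun _ => 1 / 2) r (fun p => θ p.1) (fun _ => by norm_num)
    (fun p => hθ p.1) ?_
  refine Eq.trans ?_ htr
  simp only [Matrix.trace, Matrix.diag_apply]
  have h0 : ∀ a, X 0 a a = ∑ p : Fin M × Bool, (1 / 2 : ℝ) * (r p a * r p a) := by
    intro a
    rw [← hXe, hre]
    simp only [Fintype.sum_prod_type, Fintype.sum_bool]
    refine Finset.sum_congr rfl fun l _ => ?_
    simp [r]
    ring
  simp only [h0]
  rw [Finset.sum_comm]
  refine Finset.sum_congr rfl fun p _ => ?_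
  rw [dotProduct, Finset.mul_sum]

theorem convex_sdpFeasible (N : ℕ) : Convex ℝ (sdpFeasible N) := by
  rintro p ⟨h1, h2, h3, h4⟩ p' ⟨h1', h2', h3', h4'⟩ s t hs ht hst
  have hX : ∀ n, ((s • p + t • p').1 n).IsSymm := fun n => ((h1 n).smul s).add ((h1' n).smul t)
  refine ⟨hX, fun n => ((h2 n).smul s).add ((h2' n).smul t), ?_, ?_⟩
  · have : blockToeplitz (s • p + t • p').1 + blockHankel (hankelSeq (s • p + t • p').2) =
        s • (blockToeplitz p.1 + blockHankel (hankelSeq p.2)) +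
        t • (blockToeplitz p'.1 + blockHankel (hankelSeq p'.2)) := by
      ext ⟨j, a⟩ ⟨k, b⟩
      simp only [Matrix.add_apply, Matrix.smul_apply, blockToeplitz_apply hX,
        blockToeplitz_apply h1, blockToeplitz_apply h1', blockHankel_hankelSeq_apply,
        evenExt, oddExt]
      split_ifs <;> simp <;> ring
    rw [this]
    exact (h3.smul hs).add (h3'.smul ht)
  · simp [Matrix.trace_add, h4, h4', hst]

theorem moment_mem_sdpFeasible {N : ℕ} {q : Fin 4 → ℝ} (hq : q ⬝ᵥ q = 1) (ω : ℝ) :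
    moment N q ω ∈ sdpFeasible N := by
  have ho : (outer q).IsSymm := by
    ext i j; simp [outer, Matrix.vecMulVec_apply, mul_comm]
  have hX : ∀ n, ((moment N q ω).1 n).IsSymm := fun n => ho.smul _
  refine ⟨hX, fun n => ho.smul _, ?_, ?_⟩
  -- The choice rests on `(cos α - sin α)(cos β - sin β) = cos (α - β) - sin (α + β)`; centring at
  -- `N / 2` makes the sum of the two angles `(j + k - N) ω`.
  · let u : Fin (N + 1) × Fin 4 → ℝ := fun p =>
      (Real.cos (((p.1 : ℕ) - (N : ℝ) / 2) * ω) - Real.sin (((p.1 : ℕ) - (N : ℝ) / 2) * ω)) * q p.2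
    have : blockToeplitz (moment N q ω).1 + blockHankel (hankelSeq (moment N q ω).2) =
        Matrix.vecMulVec u (star u) := by
      ext ⟨j, a⟩ ⟨k, b⟩
      have hj := j.2
      have hk := k.2
      rw [Matrix.add_apply, blockToeplitz_apply hX, blockHankel_hankelSeq_apply]
      have e1 : evenExt (moment N q ω).1 ((j : ℤ) - k) =
          Real.cos (((j : ℕ) - (k : ℕ) : ℝ) * ω) • outer q := by
        have h1 : ((j : ℤ) - k).natAbs < N + 1 := by omega
        rw [evenExt, dif_pos h1]
        simp only [moment]
        congr 1
        rw [Nat.cast_natAbs, ← Real.cos_abs, abs_mul, Int.cast_abs, abs_abs, ← abs_mul,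
          Real.cos_abs]
        push_cast; rfl
      have e2 : oddExt (moment N q ω).2 ((N : ℤ) - j - k) =
          Real.sin (((N : ℝ) - (j : ℕ) - (k : ℕ)) * ω) • outer q := by
        rcases lt_trichotomy ((N : ℤ) - j - k) 0 with h | h | h
        · have h1 : ((N : ℤ) - j - k).natAbs - 1 < N := by omega
          have h3 : ((((N : ℤ) - j - k).natAbs - 1 : ℕ) : ℝ) + 1 = -((N : ℝ) - (j : ℕ) - (k : ℕ)) := by
            have : (((((N : ℤ) - j - k).natAbs - 1 : ℕ) : ℤ) : ℝ) + 1 =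
              ((-((N : ℤ) - j - k) : ℤ) : ℝ) := by
              rw [← Int.cast_one, ← Int.cast_add]; congr 1; omega
            push_cast at this ⊢
            exact this
          rw [oddExt, dif_pos h1, Int.sign_eq_neg_one_of_neg h, neg_one_smul]
          simp only [moment]
          rw [h3, neg_mul, Real.sin_neg, neg_smul, neg_neg]
        · have h3 : ((N : ℝ) - (j : ℕ) - (k : ℕ)) = 0 := by exact_mod_cast h
          rw [h, h3]; simp [oddExt]
        · have h1 : ((N : ℤ) - j - k).natAbs - 1 < N := by omega
          have h3 : ((((N : ℤ) - j - k).natAbs - 1 : ℕ) : ℝ) + 1 = ((N : ℝ) - (j : ℕ) - (k : ℕ)) := by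
            have : (((((N : ℤ) - j - k).natAbs - 1 : ℕ) : ℤ) : ℝ) + 1 =
              ((((N : ℤ) - j - k) : ℤ) : ℝ) := by
              rw [← Int.cast_one, ← Int.cast_add]; congr 1; omega
            push_cast at this ⊢
            exact this
          rw [oddExt, dif_pos h1, Int.sign_eq_one_of_pos h, one_smul]
          simp only [moment]
          rw [h3]
      rw [e1, e2]
      have a1 : ((j : ℕ) - (k : ℕ) : ℝ) * ω =
        ((j : ℕ) - (N : ℝ) / 2) * ω - ((k : ℕ) - (N : ℝ) / 2) * ω := by ring
      have a2 : ((N : ℝ) - (j : ℕ) - (k : ℕ)) * ω =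
        -(((j : ℕ) - (N : ℝ) / 2) * ω + ((k : ℕ) - (N : ℝ) / 2) * ω) := by ring
      rw [a1, a2, Real.sin_neg, Real.cos_sub, Real.sin_add]
      simp only [Matrix.smul_apply, outer, Matrix.vecMulVec_apply, smul_eq_mul, u, star_trivial]
      ring
    rw [this]
    exact Matrix.posSemidef_vecMulVec_self_star u
  · simp [moment, outer, Matrix.trace_vecMulVec, hq]

theorem sdpFeasible_eq_convexHull (N : ℕ) : sdpFeasible N = convexHull ℝ (momentSet N) := by
  refine (sdpFeasible_subset N).antisymm (convexHull_min ?_ (convex_sdpFeasible N))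
  rintro _ ⟨q, ω, hq, -, rfl⟩
  exact moment_mem_sdpFeasible hq ω

/-! ### The trace inner product -/

theorem matInner_eq_sum {d : ℕ} (X Y : Matrix (Fin d) (Fin d) ℝ) :
    matInner X Y = ∑ i, ∑ j, X i j * Y i j := by
  rw [Finset.sum_comm]
  simp [matInner, Matrix.trace, Matrix.mul_apply]

theorem matInner_comm {d : ℕ} (X Y : Matrix (Fin d) (Fin d) ℝ) :
    matInner X Y = matInner Y X := by
  simp only [matInner_eq_sum, mul_comm]

theorem matInner_add_right {d : ℕ} (X Y Z : Matrix (Fin d) (Fin d) ℝ) :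
    matInner X (Y + Z) = matInner X Y + matInner X Z := by
  simp [matInner, mul_add]

theorem matInner_smul_right {d : ℕ} (X Y : Matrix (Fin d) (Fin d) ℝ) (t : ℝ) :
    matInner X (t • Y) = t * matInner X Y := by
  simp [matInner]

theorem matInner_add_left {d : ℕ} (X Y Z : Matrix (Fin d) (Fin d) ℝ) :
    matInner (X + Y) Z = matInner X Z + matInner Y Z := by
  simp [matInner, add_mul]

theorem matInner_sum_left {d : ℕ} {ι : Type*} (s : Finset ι) (X : ι → Matrix (Fin d) (Fin d) ℝ)
    (Z : Matrix (Fin d) (Fin d) ℝ) : matInner (∑ i ∈ s, X i) Z = ∑ i ∈ s, matInner (X i) Z := by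
  simp [matInner, Matrix.transpose_sum, Finset.sum_mul, Matrix.trace_sum]

/-! ### Unit quaternions and rotations -/

theorem quatMap_outer_mem {q : Fin 4 → ℝ} (hq : q ⬝ᵥ q = 1) :
    quatMap (outer q) ∈ Matrix.specialOrthogonalGroup (Fin 3) ℝ := by
  have h : q 0 ^ 2 + q 1 ^ 2 + q 2 ^ 2 + q 3 ^ 2 = 1 := by
    rw [← hq]; simp [dotProduct, Fin.sum_univ_four, sq]
  -- Writing `1` as `s ^ 2` or `s ^ 3` turns the claims into homogeneous polynomial identities: `Q
  -- Qᵀ = s² I` and `det Q = s³`.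
  set s := q 0 ^ 2 + q 1 ^ 2 + q 2 ^ 2 + q 3 ^ 2 with hs
  have h2 : s ^ 2 = 1 := by rw [h]; norm_num
  have h3 : s ^ 3 = 1 := by rw [h]; norm_num
  rw [Matrix.mem_specialOrthogonalGroup_iff, Matrix.mem_orthogonalGroup_iff]
  constructor
  · ext i j
    fin_cases i <;> fin_cases j <;>
      simp [quatMap, outer, Matrix.vecMulVec_apply, Matrix.mul_apply, Fin.sum_univ_three] <;>
        first | ring1 | (rw [← h2, hs]; ring1)
  · rw [← h3, hs, Matrix.det_fin_three]
    simp [quatMap, outer, Matrix.vecMulVec_apply]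
    ring

set_option maxHeartbeats 1600000 in
/-- Every rotation is represented by a unit quaternion. -/
theorem exists_quatMap_outer_eq {Q : Matrix (Fin 3) (Fin 3) ℝ}
    (hQ : Q ∈ Matrix.specialOrthogonalGroup (Fin 3) ℝ) :
    ∃ q : Fin 4 → ℝ, q ⬝ᵥ q = 1 ∧ quatMap (outer q) = Q := by
  obtain ⟨hO, hdet⟩ := Matrix.mem_specialOrthogonalGroup_iff.mp hQ
  have hrow : Q * Qᵀ = 1 := by
    simpa [Matrix.star_eq_conjTranspose] using (Matrix.mem_orthogonalGroup_iff _ _).mp hO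
  have hcol : Qᵀ * Q = 1 := by
    simpa [Matrix.star_eq_conjTranspose] using (Matrix.mem_orthogonalGroup_iff' _ _).mp hO
  have hadj : Q.adjugate = Qᵀ := by
    have h1 : Q * Q.adjugate = 1 := by rw [Matrix.mul_adjugate, hdet, one_smul]
    calc Q.adjugate = Qᵀ * Q * Q.adjugate := by rw [hcol, one_mul]
      _ = Qᵀ := by rw [mul_assoc, h1, mul_one]
  -- The candidate for `q qᵀ`: for unit `q`, applying `𝒜*` to `𝒜 (q qᵀ)` gives `4 q qᵀ - I`.
  set Z : Matrix (Fin 4) (Fin 4) ℝ := (1 / 4 : ℝ) • (1 + quatAdj Q) with hZ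
  -- These minors force rank at most one. They are linear combinations of the orthogonality
  -- relations and of `adj Q = Qᵀ`, where `det Q = 1` enters.
  have hmin : ∀ i a b, Z i a * Z i b = Z i i * Z a b := by
    have hr := fun i j => congrFun (congrFun hrow i) j
    have hc := fun i j => congrFun (congrFun hcol i) j
    have ha := fun i j => congrFun (congrFun hadj i) j
    rw [Matrix.adjugate_fin_three] at ha
    have r00 := hr 0 0
    have r01 := hr 0 1
    have r02 := hr 0 2
    have r11 := hr 1 1
    have r12 := hr 1 2
    have r22 := hr 2 2
    have c00 := hc 0 0
    have c01 := hc 0 1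
    have c02 := hc 0 2
    have c11 := hc 1 1
    have c12 := hc 1 2
    have c22 := hc 2 2
    have a00 := ha 0 0
    have a01 := ha 0 1
    have a02 := ha 0 2
    have a10 := ha 1 0
    have a11 := ha 1 1
    have a12 := ha 1 2
    have a20 := ha 2 0
    have a21 := ha 2 1
    have a22 := ha 2 2
    clear ha hc hr hadj hcol hrow hO hdet hQ
    simp [Matrix.mul_apply, Fin.sum_univ_three] at r00 r01 r02 r11 r12 r22 c00 c01 c02 c11 c12 c22
    simp at a00 a01 a02 a10 a11 a12 a20 a21 a22
    intro i a b
    fin_cases i <;> fin_cases a <;> fin_cases b <;>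
      simp [hZ, quatAdj] <;> first | ring1 | linarith
  have htr : Z 0 0 + Z 1 1 + Z 2 2 + Z 3 3 = 1 := by
    simp [hZ, quatAdj]; ring
  have hmap : quatMap Z = Q := by
    ext i j
    fin_cases i <;> fin_cases j <;> simp [hZ, quatMap, quatAdj] <;> ring
  obtain ⟨i, hi⟩ : ∃ i, 0 < Z i i := by
    by_contra! h
    linarith [h 0, h 1, h 2, h 3]
  have hs : √(Z i i) ^ 2 = Z i i := Real.sq_sqrt hi.le
  have hout : outer (fun a => Z i a / √(Z i i)) = Z := by
    ext a b
    rw [outer, Matrix.vecMulVec_apply, div_mul_div_comm, ← sq, hs, hmin,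
      mul_div_cancel_left₀ _ hi.ne']
  refine ⟨fun a => Z i a / √(Z i i), ?_, by rw [hout, hmap]⟩
  have : ∀ a, Z i a / √(Z i i) * (Z i a / √(Z i i)) = Z a a := fun a => by
    rw [← Matrix.vecMulVec_apply]; exact congrFun (congrFun hout a) a
  simp only [dotProduct, this, Fin.sum_univ_four, htr]

/-! ### Exactness for the trigonometric Wahba problem -/

theorem sdpObj_moment {N : ℕ} (A : Fin (N + 1) → Matrix (Fin 3) (Fin 3) ℝ)
    (B : Fin N → Matrix (Fin 3) (Fin 3) ℝ) (q : Fin 4 → ℝ) (ω : ℝ) :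
    sdpObj A B (moment N q ω) = wahbaObj A B (ω, quatMap (outer q)) := by
  have ho : (outer q).IsSymm := by
    ext i j; simp [outer, Matrix.vecMulVec_apply, mul_comm]
  have h : ∀ Y, matInner (quatAdj Y) (outer q) = matInner Y (quatMap (outer q)) := fun Y => by
    rw [matInner_comm, ← matInner_quatMap _ ho, matInner_comm]
  simp [sdpObj, wahbaObj, moment, matInner_smul_right, h]

theorem isLinearMap_sdpObj {N : ℕ} (A : Fin (N + 1) → Matrix (Fin 3) (Fin 3) ℝ)
    (B : Fin N → Matrix (Fin 3) (Fin 3) ℝ) : IsLinearMap ℝ (sdpObj A B) where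
  map_add p r := by
    simp only [sdpObj, Prod.fst_add, Prod.snd_add, Pi.add_apply, matInner_add_right,
      Finset.sum_add_distrib]
    ring
  map_smul t p := by
    simp only [sdpObj, Prod.smul_fst, Prod.smul_snd, Pi.smul_apply, matInner_smul_right,
      smul_eq_mul, mul_add, Finset.mul_sum]

/-- The face of a convex hull on which a linear functional is maximal is the convex hull of the
generators lying in it. -/
theorem convexHull_inter_eq {E : Type*} [AddCommGroup E] [Module ℝ E] {S : Set E} {f : E → ℝ}
    (hf : IsLinearMap ℝ f) {v : ℝ} (hv : ∀ p ∈ S, f p ≤ v) :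
    convexHull ℝ S ∩ {p | f p = v} = convexHull ℝ (S ∩ {p | f p = v}) := by
  classical
  apply Set.Subset.antisymm
  · rintro p ⟨hp, hpv⟩
    obtain ⟨ι, _, w, z, hw, hw1, hz, rfl⟩ := mem_convexHull_iff_exists_fintype.mp hp
    -- A vanishing sum of nonnegative terms: every point of positive weight attains `v`.
    have hsum : ∑ i, w i * (v - f (z i)) = 0 := by
      have h : f (∑ i, w i • z i) = ∑ i, w i * f (z i) := by
        refine (map_sum (hf.mk' f) (fun i => w i • z i) Finset.univ).trans ?_
        exact Finset.sum_congr rfl fun i _ => hf.map_smul _ _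
      rw [Set.mem_ofPred_eq, h] at hpv
      simp only [mul_sub, Finset.sum_sub_distrib, ← Finset.sum_mul, hw1, hpv, one_mul, sub_self]
    have hzero := (Finset.sum_eq_zero_iff_of_nonneg fun i _ =>
      mul_nonneg (hw i) (sub_nonneg.mpr (hv _ (hz i)))).mp hsum
    rw [← Finset.sum_filter_add_sum_filter_not Finset.univ (fun i => w i ≠ 0)] at hw1 ⊢
    have h0 : ∀ i ∈ Finset.univ.filter (fun i => ¬ w i ≠ 0), w i = 0 := fun i hi => by
      simpa using hi
    rw [Finset.sum_eq_zero h0, add_zero] at hw1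
    rw [Finset.sum_eq_zero (s := Finset.univ.filter (fun i => ¬ w i ≠ 0))
      (fun i hi => by rw [h0 i hi, zero_smul]), add_zero]
    refine (convex_convexHull ℝ _).sum_mem (fun i _ => hw i) hw1 fun i hi => ?_
    refine subset_convexHull ℝ _ ⟨hz i, ?_⟩
    have hi' : w i ≠ 0 := by simpa using hi
    have := (mul_eq_zero.mp (hzero i (Finset.mem_univ i))).resolve_left hi'
    exact (sub_eq_zero.mp this).symm
  · exact convexHull_min (Set.inter_subset_inter_left _ (subset_convexHull ℝ S))
      ((convex_convexHull ℝ S).inter (convex_hyperplane hf v))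

theorem exists_isMaxOn_wahbaObj {N : ℕ} (A : Fin (N + 1) → Matrix (Fin 3) (Fin 3) ℝ)
    (B : Fin N → Matrix (Fin 3) (Fin 3) ℝ) :
    ∃ s ∈ wahbaDomain, IsMaxOn (wahbaObj A B) wahbaDomain s := by
  let K : Set (ℝ × (Fin 4 → ℝ)) := Set.Icc (-Real.pi) Real.pi ×ˢ {q | q ⬝ᵥ q = 1}
  have hK : IsCompact K := by
    refine isCompact_Icc.prod (Metric.isCompact_of_isClosed_isBounded ?_ ?_)
    · exact isClosed_eq (by unfold dotProduct; fun_prop) continuous_const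
    · refine (Metric.isBounded_closedBall (x := (0 : Fin 4 → ℝ)) (r := 1)).subset fun q hq => ?_
      rw [mem_closedBall_zero_iff, pi_norm_le_iff_of_nonneg zero_le_one]
      intro i
      rw [Real.norm_eq_abs, ← sq_le_one_iff_abs_le_one, sq]
      exact (Finset.single_le_sum (f := fun i => q i * q i) (fun i _ => mul_self_nonneg _)
        (Finset.mem_univ i)).trans_eq hq
  have hne : K.Nonempty := ⟨(0, Pi.single 0 1), ⟨by linarith [Real.pi_pos], Real.pi_pos.le⟩,
    by simp⟩
  have hcont : Continuous fun r : ℝ × (Fin 4 → ℝ) =>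
      wahbaObj A B (r.1, quatMap (outer r.2)) := by
    have h1 : Continuous fun r : ℝ × (Fin 4 → ℝ) => quatMap (outer r.2) := by
      refine continuous_matrix fun i j => ?_
      fin_cases i <;> fin_cases j <;> simp [quatMap, outer, Matrix.vecMulVec_apply] <;> fun_prop
    have h2 : ∀ (Y : Matrix (Fin 3) (Fin 3) ℝ), Continuous fun r : ℝ × (Fin 4 → ℝ) =>
        matInner Y (quatMap (outer r.2)) := fun Y => by
      simp only [matInner_eq_sum]
      exact continuous_finsetSum _ fun i _ => continuous_finsetSum _ fun j _ =>
        continuous_const.mul (h1.matrix_elem i j)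
    simp only [wahbaObj, matInner_smul_right]
    fun_prop
  obtain ⟨⟨ω, q⟩, ⟨hω, hq⟩, hmax⟩ := hK.exists_isMaxOn hne hcont.continuousOn
  -- Compactness needed the closed interval; by periodicity a maximiser at `π` moves to `-π`.
  obtain ⟨ω', hω', he⟩ : ∃ ω' ∈ Set.Ico (-Real.pi) Real.pi, ∀ Q,
      wahbaObj A B (ω', Q) = wahbaObj A B (ω, Q) := by
    rcases hω.2.lt_or_eq with h | h
    · exact ⟨ω, ⟨hω.1, h⟩, fun _ => rfl⟩
    · refine ⟨-Real.pi, ⟨le_rfl, by linarith [Real.pi_pos]⟩, fun Q => ?_⟩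
      simp only at h
      have hs : ∀ n : ℕ, Real.sin (((n : ℝ) + 1) * Real.pi) = 0 := fun n => by
        exact_mod_cast Real.sin_nat_mul_pi (n + 1)
      simp [wahbaObj, h, hs]
  refine ⟨(ω', quatMap (outer q)), ⟨hω', quatMap_outer_mem hq⟩, ?_⟩
  rintro ⟨ω₁, Q₁⟩ ⟨hω₁, hQ₁⟩
  obtain ⟨q₁, hq₁, rfl⟩ := exists_quatMap_outer_eq hQ₁
  have := hmax (show (ω₁, q₁) ∈ K from ⟨⟨hω₁.1, hω₁.2.le⟩, hq₁⟩)
  simp only [Set.mem_ofPred_eq] at this ⊢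
  rw [he]
  exact this

/-- The trigonometric Wahba problem and its semidefinite relaxation have the same value, and the
optimal points of the latter are the convex combinations of the optimal moment tuples. -/
theorem wahba_sdp_exact {N : ℕ} (A : Fin (N + 1) → Matrix (Fin 3) (Fin 3) ℝ)
    (B : Fin N → Matrix (Fin 3) (Fin 3) ℝ) :
    (∃ v : ℝ, IsGreatest (wahbaObj A B '' wahbaDomain) v ∧
      IsGreatest (sdpObj A B '' sdpFeasible N) v) ∧
    sdpOptimal A B = convexHull ℝ {p : Tuple N | ∃ (q : Fin 4 → ℝ) (ω : ℝ),
      q ⬝ᵥ q = 1 ∧ (ω, quatMap (outer q)) ∈ wahbaDomain ∧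
      IsMaxOn (wahbaObj A B) wahbaDomain (ω, quatMap (outer q)) ∧ p = moment N q ω} := by
  obtain ⟨⟨ω₀, Q₀⟩, hs, hmax⟩ := exists_isMaxOn_wahbaObj A B
  obtain ⟨q₀, hq₀, rfl⟩ := exists_quatMap_outer_eq hs.2
  set v := wahbaObj A B (ω₀, quatMap (outer q₀)) with hv
  have hle : ∀ p ∈ momentSet N, sdpObj A B p ≤ v := by
    rintro _ ⟨q, ω, hq, hω, rfl⟩
    rw [sdpObj_moment]
    exact hmax (show (ω, quatMap (outer q)) ∈ wahbaDomain from ⟨hω, quatMap_outer_mem hq⟩)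
  have hle' : ∀ p ∈ sdpFeasible N, sdpObj A B p ≤ v := by
    rw [sdpFeasible_eq_convexHull]
    exact convexHull_min hle (convex_halfSpace_le (isLinearMap_sdpObj A B) v)
  have hmem : moment N q₀ ω₀ ∈ sdpFeasible N := moment_mem_sdpFeasible hq₀ ω₀
  have hval : sdpObj A B (moment N q₀ ω₀) = v := sdpObj_moment A B q₀ ω₀
  refine ⟨⟨v, ⟨⟨_, hs, rfl⟩, ?_⟩, ⟨⟨_, hmem, hval⟩, ?_⟩⟩, ?_⟩
  · rintro _ ⟨s, hs', rfl⟩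
    exact hmax hs'
  · rintro _ ⟨p, hp, rfl⟩
    exact hle' p hp
  · have h1 : sdpOptimal A B = convexHull ℝ (momentSet N) ∩ {p | sdpObj A B p = v} := by
      rw [← sdpFeasible_eq_convexHull]
      ext p
      refine and_congr_right fun hp => ⟨fun h => (hle' p hp).antisymm ?_, fun h r hr => ?_⟩
      · rw [← hval]; exact h hmem
      · exact (hle' r hr).trans_eq h.symm
    rw [h1, convexHull_inter_eq (isLinearMap_sdpObj A B) hle]
    congr 1
    ext p
    constructor
    · rintro ⟨⟨q, ω, hq, hω, rfl⟩, hp⟩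
      refine ⟨q, ω, hq, ⟨hω, quatMap_outer_mem hq⟩, fun s hs' => ?_, rfl⟩
      rw [Set.mem_ofPred_eq, sdpObj_moment] at hp
      exact (hmax hs').trans_eq hp.symm
    · rintro ⟨q, ω, hq, hω, hm, rfl⟩
      refine ⟨⟨q, ω, hq, hω.1, rfl⟩, ?_⟩
      rw [Set.mem_ofPred_eq, sdpObj_moment]
      exact (hmax hω).antisymm (hm hs)

/-! ### Reduction of Psiaki's first problem -/

theorem spin_mem_orthogonalGroup (θ : ℝ) : spin θ ∈ Matrix.orthogonalGroup (Fin 3) ℝ := by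
  rw [Matrix.mem_orthogonalGroup_iff]
  have h := Real.sin_sq_add_cos_sq θ
  ext i j
  fin_cases i <;> fin_cases j <;>
    simp [spin, Matrix.mul_apply, Fin.sum_univ_three] <;> linarith

theorem norm_sub_orthogonal_mulVec_sq {P : Matrix (Fin 3) (Fin 3) ℝ}
    (hP : P ∈ Matrix.orthogonalGroup (Fin 3) ℝ) (x y : EuclideanSpace ℝ (Fin 3)) :
    ‖y - WithLp.toLp 2 (P *ᵥ x.ofLp)‖ ^ 2 =
      ‖y‖ ^ 2 + ‖x‖ ^ 2 - 2 * (y.ofLp ⬝ᵥ P *ᵥ x.ofLp) := by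
  have hcol : Pᵀ * P = 1 := by
    simpa [Matrix.star_eq_conjTranspose] using (Matrix.mem_orthogonalGroup_iff' _ _).mp hP
  have hn : ∀ z : EuclideanSpace ℝ (Fin 3), ‖z‖ ^ 2 = z.ofLp ⬝ᵥ z.ofLp := fun z => by
    rw [EuclideanSpace.real_norm_sq_eq]; simp [dotProduct, sq]
  have hx : (P *ᵥ x.ofLp) ⬝ᵥ (P *ᵥ x.ofLp) = x.ofLp ⬝ᵥ x.ofLp := by
    rw [Matrix.dotProduct_mulVec, Matrix.vecMul_mulVec, hcol, Matrix.vecMul_one]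
  rw [hn, hn, hn, WithLp.ofLp_sub, sub_dotProduct, dotProduct_sub, dotProduct_sub, hx,
    dotProduct_comm (P *ᵥ x.ofLp) y.ofLp]
  ring

theorem matInner_vecMulVec {d : ℕ} (x y : Fin d → ℝ) (Q : Matrix (Fin d) (Fin d) ℝ) :
    matInner (Matrix.vecMulVec y x) Q = y ⬝ᵥ Q *ᵥ x := by
  simp only [matInner_eq_sum, Matrix.vecMulVec_apply, dotProduct, Matrix.mulVec, Finset.mul_sum]
  exact Finset.sum_congr rfl fun i _ => Finset.sum_congr rfl fun j _ => by ring

theorem matInner_smul_left {d : ℕ} (X Y : Matrix (Fin d) (Fin d) ℝ) (t : ℝ) :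
    matInner (t • X) Y = t * matInner X Y := by
  rw [matInner_comm, matInner_smul_right, matInner_comm]

/-- Split `spin θ` into its constant, cosine and sine parts. Moving each to the other side of the
inner product transposes it, which flips the sign of the skew sine part. -/
theorem dotProduct_spin_mul_mulVec (θ : ℝ) (Q : Matrix (Fin 3) (Fin 3) ℝ) (x y : Fin 3 → ℝ) :
    y ⬝ᵥ (spin θ * Q) *ᵥ x =
      matInner (!![1, 0, 0; 0, 0, 0; 0, 0, 0] * Matrix.vecMulVec y x) Q +
      (Real.cos θ * matInner (!![0, 0, 0; 0, 1, 0; 0, 0, 1] * Matrix.vecMulVec y x) Q +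
        Real.sin θ * matInner (!![0, 0, 0; 0, 0, 1; 0, -1, 0] * Matrix.vecMulVec y x) Q) := by
  simp [matInner_eq_sum, Matrix.vecMulVec_apply, dotProduct, Matrix.mulVec, Matrix.vecMul, spin,
    Matrix.mul_apply, Fin.sum_univ_three]
  ring

/-- Since `spin` times `Q` is orthogonal, each squared residual depends on `(ω, Q)` only through its
cross term. The axis components do not rotate, so they are all collected in `A 0`. -/
theorem psiakiCost_eq {N : ℕ} (τ : ℝ) (κ : Fin (N + 1) → ℝ)
    (x y : Fin (N + 1) → EuclideanSpace ℝ (Fin 3)) (ω : ℝ) {Q : Matrix (Fin 3) (Fin 3) ℝ}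
    (hQ : Q ∈ Matrix.specialOrthogonalGroup (Fin 3) ℝ) :
    psiakiCost τ κ x y (ω, Q) = ∑ n, κ n / 2 * (‖y n‖ ^ 2 + ‖x n‖ ^ 2) -
      wahbaObj (psiakiA κ x y) (psiakiB κ x y) (τ * ω, Q) := by
  have hO := (Matrix.mem_specialOrthogonalGroup_iff.mp hQ).1
  have h1 : psiakiCost τ κ x y (ω, Q) = ∑ n, κ n / 2 * (‖y n‖ ^ 2 + ‖x n‖ ^ 2) -
      ∑ n : Fin (N + 1), κ n * ((y n).ofLp ⬝ᵥ (spin (ω * ((n : ℕ) * τ)) * Q) *ᵥ (x n).ofLp) := by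
    rw [psiakiCost, ← Finset.sum_sub_distrib]
    refine Finset.sum_congr rfl fun n _ => ?_
    rw [norm_sub_orthogonal_mulVec_sq (mul_mem (spin_mem_orthogonalGroup _) hO)]
    ring
  rw [h1]
  congr 1
  have h0 : spin 0 = 1 := by
    ext i j
    fin_cases i <;> fin_cases j <;> simp [spin]
  rw [Fin.sum_univ_succ]
  simp only [wahbaObj, psiakiA, psiakiB, Fin.cons_zero, Fin.cons_succ, matInner_add_left,
    Finset.mul_sum, matInner_sum_left, matInner_smul_left, matInner_smul_right, Matrix.mul_smul,
    Fin.val_zero, Nat.cast_zero, zero_mul, mul_zero, h0, one_mul, matInner_vecMulVec]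
  rw [add_assoc, ← Finset.sum_add_distrib]
  congr 1
  refine Finset.sum_congr rfl fun n _ => ?_
  have e : ω * (((n.succ : Fin (N + 1)) : ℕ) * τ) = (((n : ℕ) : ℝ) + 1) * (τ * ω) := by
    rw [Fin.val_succ]; push_cast; ring
  rw [dotProduct_spin_mul_mulVec, e]
  ring

theorem mem_psiakiDomain_iff {τ : ℝ} (hτ : 0 < τ) (ω : ℝ) (Q : Matrix (Fin 3) (Fin 3) ℝ) :
    (ω, Q) ∈ psiakiDomain τ ↔ (τ * ω, Q) ∈ wahbaDomain := by
  simp only [psiakiDomain, wahbaDomain, Set.mem_ofPred_eq, Set.mem_Ico]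
  rw [← neg_div, div_le_iff₀' hτ, lt_div_iff₀' hτ]

/-- The semidefinite reformulation of Psiaki's first problem. -/
theorem psiaki_sdp_exact {N : ℕ} {τ : ℝ} (κ : Fin (N + 1) → ℝ)
    (x y : Fin (N + 1) → EuclideanSpace ℝ (Fin 3)) (hτ : 0 < τ) :
    (∃ v : ℝ, IsLeast (psiakiCost τ κ x y '' psiakiDomain τ)
        (∑ n, κ n / 2 * (‖y n‖ ^ 2 + ‖x n‖ ^ 2) - v) ∧
      IsGreatest (sdpObj (psiakiA κ x y) (psiakiB κ x y) '' sdpFeasible N) v) ∧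
    sdpOptimal (psiakiA κ x y) (psiakiB κ x y) =
      convexHull ℝ {p : Tuple N | ∃ (q : Fin 4 → ℝ) (ω : ℝ),
        q ⬝ᵥ q = 1 ∧ (ω, quatMap (outer q)) ∈ psiakiDomain τ ∧
        IsMinOn (psiakiCost τ κ x y) (psiakiDomain τ) (ω, quatMap (outer q)) ∧
        p = moment N q (τ * ω)} := by
  obtain ⟨⟨v, ⟨⟨⟨ω₀, Q₀⟩, hs₀, hv₀⟩, hv⟩, hsdp⟩, hopt⟩ :=
    wahba_sdp_exact (psiakiA κ x y) (psiakiB κ x y)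
  have hτω : ∀ ω, τ * (ω / τ) = ω := fun ω => mul_div_cancel₀ ω hτ.ne'
  refine ⟨⟨v, ⟨⟨(ω₀ / τ, Q₀), ?_, ?_⟩, ?_⟩, hsdp⟩, ?_⟩
  · rwa [mem_psiakiDomain_iff hτ, hτω]
  · rw [psiakiCost_eq τ κ x y _ hs₀.2, hτω, hv₀]
  · rintro _ ⟨⟨ω, Q⟩, hs, rfl⟩
    rw [psiakiCost_eq τ κ x y _ hs.2]
    exact sub_le_sub_left (hv ⟨_, (mem_psiakiDomain_iff hτ ω Q).mp hs, rfl⟩) _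
  · have hiff : ∀ (ω : ℝ) (Q : Matrix (Fin 3) (Fin 3) ℝ), (ω, Q) ∈ psiakiDomain τ →
        (IsMinOn (psiakiCost τ κ x y) (psiakiDomain τ) (ω, Q) ↔
          IsMaxOn (wahbaObj (psiakiA κ x y) (psiakiB κ x y)) wahbaDomain (τ * ω, Q)) := by
      intro ω Q hs
      constructor
      · rintro h ⟨ω', Q'⟩ hs'
        have h' := h (show (ω' / τ, Q') ∈ psiakiDomain τ by
          rwa [mem_psiakiDomain_iff hτ, hτω])
        simp only [Set.mem_ofPred_eq] at h' ⊢
        rw [psiakiCost_eq τ κ x y _ hs.2, psiakiCost_eq τ κ x y _ hs'.2, hτω] at h'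
        linarith
      · rintro h ⟨ω', Q'⟩ hs'
        have h' := h ((mem_psiakiDomain_iff hτ ω' Q').mp hs')
        simp only [Set.mem_ofPred_eq] at h' ⊢
        rw [psiakiCost_eq τ κ x y _ hs.2, psiakiCost_eq τ κ x y _ hs'.2]
        linarith
    rw [hopt]
    congr 1
    ext p
    constructor
    · rintro ⟨q, ω, hq, hs, hm, rfl⟩
      have hs' : (ω / τ, quatMap (outer q)) ∈ psiakiDomain τ := by
        rwa [mem_psiakiDomain_iff hτ, hτω]
      refine ⟨q, ω / τ, hq, hs', (hiff _ _ hs').mpr ?_, ?_⟩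
      · rwa [hτω]
      · rw [hτω]
    · rintro ⟨q, ω, hq, hs, hm, rfl⟩
      exact ⟨q, τ * ω, hq, (mem_psiakiDomain_iff hτ _ _).mp hs, (hiff _ _ hs).mp hm, rfl⟩

end TrigWahba

theorem theorem1 (N : ℕ) :
    (∀ (A : Fin (N + 1) → Matrix (Fin 3) (Fin 3) ℝ) (B : Fin N → Matrix (Fin 3) (Fin 3) ℝ),
      (∃ v : ℝ, IsGreatest (TrigWahba.wahbaObj A B '' TrigWahba.wahbaDomain) v ∧
        IsGreatest (TrigWahba.sdpObj A B '' TrigWahba.sdpFeasible N) v) ∧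
      TrigWahba.sdpOptimal A B =
        convexHull ℝ {p : TrigWahba.Tuple N | ∃ (q : Fin 4 → ℝ) (ω : ℝ),
          q ⬝ᵥ q = 1 ∧
          (ω, TrigWahba.quatMap (TrigWahba.outer q)) ∈ TrigWahba.wahbaDomain ∧
          IsMaxOn (TrigWahba.wahbaObj A B) TrigWahba.wahbaDomain
            (ω, TrigWahba.quatMap (TrigWahba.outer q)) ∧
          p = TrigWahba.moment N q ω}) ∧
    (∀ (τ : ℝ) (κ : Fin (N + 1) → ℝ) (x y : Fin (N + 1) → EuclideanSpace ℝ (Fin 3)),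
      0 < τ →
      (∃ v : ℝ, IsLeast (TrigWahba.psiakiCost τ κ x y '' TrigWahba.psiakiDomain τ)
          (∑ n, κ n / 2 * (‖y n‖ ^ 2 + ‖x n‖ ^ 2) - v) ∧
        IsGreatest (TrigWahba.sdpObj (TrigWahba.psiakiA κ x y) (TrigWahba.psiakiB κ x y) ''
          TrigWahba.sdpFeasible N) v) ∧
      TrigWahba.sdpOptimal (TrigWahba.psiakiA κ x y) (TrigWahba.psiakiB κ x y) =
        convexHull ℝ {p : TrigWahba.Tuple N | ∃ (q : Fin 4 → ℝ) (ω : ℝ),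
          q ⬝ᵥ q = 1 ∧
          (ω, TrigWahba.quatMap (TrigWahba.outer q)) ∈ TrigWahba.psiakiDomain τ ∧
          IsMinOn (TrigWahba.psiakiCost τ κ x y) (TrigWahba.psiakiDomain τ)
            (ω, TrigWahba.quatMap (TrigWahba.outer q)) ∧
          p = TrigWahba.moment N q (τ * ω)}) := by
  exact ⟨TrigWahba.wahba_sdp_exact,
    fun _ κ x y hτ => TrigWahba.psiaki_sdp_exact κ x y hτ⟩
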